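/- Let $M=[m]=\{1,\dots,m\}$ be a set of indivisible items and let there be two players. A valuation is a vector $v_i=(v_{ij})_{j\in M}$ of strictly positive reals, extended additively by $v_i(S)=\sum_{j\in S}v_{ij}$ for $S\subseteq M$. A mechanism $\mathcal X$ maps every profile $\mathbf v=(v_1,v_2)$ to an ordered partition $(X_1(\mathbf v),X_2(\mathbf v))$ of $M$ (a part may be empty). It is truthful if $v_i(X_i(\mathbf v))\ge v_i(X_i(v_i',v_{-i}))$ for all $\mathbf v$, $i$ and $v_i'$. It is Pareto efficient if for no profile $\mathbf v$ there is an allocation $(A_1,A_2)$ of $M$ with $v_i(A_i)\ge v_i(X_i(\mathbf v))$ for both $i$ and strict inequality for at least one $i$. A set of offers on a nonempty set $S$ is a nonempty collection $\mathcal O$ of proper subsets of $S$ with $\bigcup_{T\in\mathcal O}T=S$ and $\bigcap_{T\in\mathcal O}T=\emptyset$; on $S=\emptyset$ the only set of offers is $\{\emptyset\}$. A valid set of exchange deals on disjoint sets $(S,T)$ is a (possibly empty) finite set $D=\{(S_1,T_1),\dots,(S_k,T_k)\}$ such that $S_1,\dots,S_k$ are nonempty, pairwise disjoint subsets of $S$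 and $T_1,\dots,T_k$ are nonempty, pairwise disjoint subsets of $T$. A deal $(S_l,T_l)$ is favorable at $\mathbf v$ if $v_1(T_l)>v_1(S_l)$ and $v_2(S_l)>v_2(T_l)$, and unfavorable at $\mathbf v$ if $v_1(T_l)<v_1(S_l)$ or $v_2(S_l)<v_2(T_l)$. $\mathcal X$ is a picking-exchange mechanism with components $(N_1,N_2,E_1,E_2,\mathcal O_1,\mathcal O_2,D)$ if $(N_1,N_2,E_1,E_2)$ is a partition of $M$ (parts may be empty), $\mathcal O_i$ is a set of offers on $N_i$ for $i=1,2$, $D=\{(S_1,T_1),\dots,(S_k,T_k)\}$ is a valid set of exchange deals on $(E_1,E_2)$, and for every profile $\mathbf v$ $$X_i(\mathbf v)\cap N_i\in\operatorname*{arg\,max}_{S\in\mathcal O_i}v_i(S)\quad(i=1,2),\qquad X_1(\mathbf v)\cap(E_1\cup E_2)=\Big(E_1\setminus\bigcup_{l\in I}S_l\Big)\cup\bigcup_{l\in I}T_l$$ for some $I=I(\mathbf v)\subseteq[k]$ that contains the indices of all deals favorable at $\mathbf v$ and of no deal unfavorable at $\mathbf v$. **Corollary.** Every Pareto efficient, truthful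 mechanism $\mathcal X$ is a picking-exchange mechanism with some components $(N_1,N_2,E_1,E_2,\mathcal O_1,\mathcal O_2,D)$ such that 1. there is $i\in\{1,2\}$ with $E_i=[m]$, or 2. there are $j\in[m]$ and $i_1,i_2$ with $\{i_1,i_2\}=\{1,2\}$, $E_{i_1}=\{j\}$, $E_{i_2}=[m]\setminus\{j\}$, and $D=\{(E_1,E_2)\}$, or 3. there is $i\in\{1,2\}$ with $N_i=[m]$ and $\mathcal O_i=\{S\subseteq N_i : |S|=m-1\}$. -/

import Mathlib

namespace TwoPlayer

/-- An additive valuation on the items `Fin m`: a strictly positive value for every item. -/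
abbrev Valuation (m : ℕ) := Fin m → {x : ℝ // 0 < x}

/-- The value of a set of items under an additive valuation. -/
noncomputable def Valuation.value {m : ℕ} (w : Valuation m) (S : Finset (Fin m)) : ℝ :=
  ∑ j ∈ S, (w j : ℝ)

/-- A profile: one valuation for each of the two players. Player 1 is `0 : Fin 2` and player 2 is
`1 : Fin 2`. -/
abbrev Profile (m : ℕ) := Fin 2 → Valuation m

/-- An allocation of all the items: an ordered partition of the items into two bundles, either of
which may be empty. -/
structure Allocation (m : ℕ) where
  bundle : Fin 2 → Finset (Fin m)
  disjoint : Disjoint (bundle 0) (bundle 1)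
  cover : bundle 0 ∪ bundle 1 = Finset.univ

/-- A deterministic mechanism without payments for allocating all the items. -/
abbrev Mechanism (m : ℕ) := Profile m → Allocation m

/-- No player ever gains by misreporting. -/
def Mechanism.Truthful {m : ℕ} (X : Mechanism m) : Prop :=
  ∀ (v : Profile m) (i : Fin 2) (w : Valuation m),
    (v i).value ((X (Function.update v i w)).bundle i) ≤ (v i).value ((X v).bundle i)

/-- At every profile, no other allocation is strictly better for one player and at least as good
for every player. -/
def Mechanism.ParetoEfficient {m : ℕ} (X : Mechanism m) : Prop :=
  ∀ v : Profile m, ¬ ∃ A : Allocation m,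
    (∀ i, (v i).value ((X v).bundle i) ≤ (v i).value (A.bundle i)) ∧
    (∃ i, (v i).value ((X v).bundle i) < (v i).value (A.bundle i))

/-- `O` is a set of offers on `S`: a nonempty collection of proper subsets of `S` with union `S`
and with no element common to all of them. The empty set has no proper subsets; on it the only
(trivial) set of offers is `{∅}`. -/
def IsSetOfOffers {m : ℕ} (O : Finset (Finset (Fin m))) (S : Finset (Fin m)) : Prop :=
  (S = ∅ ∧ O = {∅}) ∨
  (O.Nonempty ∧ (∀ T ∈ O, T ⊂ S) ∧ O.biUnion id = S ∧ ∀ x, ∃ T ∈ O, x ∉ T)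

/-- An exchange deal `(S, T)`: player 1 gives `S` to player 2 and receives `T`. -/
abbrev Deal (m : ℕ) := Finset (Fin m) × Finset (Fin m)

/-- Both players strictly gain from the deal. -/
def Deal.Favorable {m : ℕ} (d : Deal m) (v : Profile m) : Prop :=
  (v 0).value d.1 < (v 0).value d.2 ∧ (v 1).value d.2 < (v 1).value d.1

/-- Some player strictly loses from the deal. -/
def Deal.Unfavorable {m : ℕ} (d : Deal m) (v : Profile m) : Prop :=
  (v 0).value d.2 < (v 0).value d.1 ∨ (v 1).value d.1 < (v 1).value d.2

/-- `D` is a valid set of exchange deals on `(S, T)`: the sets given by player 1 are nonempty,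
pairwise disjoint subsets of `S`, and those given by player 2 are nonempty, pairwise disjoint
subsets of `T`. -/
def IsValidDeals {m : ℕ} (D : Finset (Deal m)) (S T : Finset (Fin m)) : Prop :=
  (∀ d ∈ D, d.1.Nonempty ∧ d.1 ⊆ S ∧ d.2.Nonempty ∧ d.2 ⊆ T) ∧
  (∀ d ∈ D, ∀ e ∈ D, d ≠ e → Disjoint d.1 e.1 ∧ Disjoint d.2 e.2)

/-- The components of a picking-exchange mechanism: a partition `(N 0, N 1, E 0, E 1)` of the items
(parts may be empty), a set of offers `O i` on each `N i`, and a valid set `D` of exchange deals on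
the endowments `(E 0, E 1)`. -/
structure PickingExchange (m : ℕ) where
  N : Fin 2 → Finset (Fin m)
  E : Fin 2 → Finset (Fin m)
  O : Fin 2 → Finset (Finset (Fin m))
  D : Finset (Deal m)
  disjoint_N : Disjoint (N 0) (N 1)
  disjoint_E : Disjoint (E 0) (E 1)
  disjoint_N_E : ∀ i j, Disjoint (N i) (E j)
  cover : N 0 ∪ N 1 ∪ E 0 ∪ E 1 = Finset.univ
  offers : ∀ i, IsSetOfOffers (O i) (N i)
  valid : IsValidDeals D (E 0) (E 1)

/-- The mechanism `X` is a picking-exchange mechanism with components `P`: at every profile, each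
player `i` receives from `N i` a best offer in `O i`, and the endowments are modified by performing
a set `I` of deals that contains all favorable and no unfavorable deals of `D`. -/
def PickingExchange.Implements {m : ℕ} (P : PickingExchange m) (X : Mechanism m) : Prop :=
  ∀ v : Profile m,
    (∀ i, (X v).bundle i ∩ P.N i ∈ P.O i ∧
      ∀ S ∈ P.O i, (v i).value S ≤ (v i).value ((X v).bundle i ∩ P.N i)) ∧
    ∃ I ⊆ P.D,
      (∀ d ∈ P.D, d.Favorable v → d ∈ I) ∧
      (∀ d ∈ I, ¬ d.Unfavorable v) ∧
      (X v).bundle 0 ∩ (P.E 0 ∪ P.E 1) = (P.E 0 \ I.biUnion Prod.fst) ∪ I.biUnion Prod.snd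

end TwoPlayer

namespace TwoPlayer

open Finset

/-! ### Natural weights and secured sets -/

section Combinatorial

variable {ι : Type*}

/-! Call a set secured by a player if truth-telling always guarantees her at least its value.
Truthfulness turns a single well-chosen profile into such a guarantee (`secures_of_disjoint`), and
it follows that every single item is secured by one of the players (`secures_or_swapPlayers`).

If neither player secures all singletons, each secures an item that the other does not. A third item
would give one player two secured singletons against one of the other's, which `three_items`
excludes. So there are just two items, and efficiency makes the mechanism a swap by consent.

Otherwise some player secures all singletons, and induction on the size gives her all proper subsets
(`secures_of_ne_univ`, from `secures_insert_or` and `secures_erase`). Either she secures the whole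
set and owns everything, or she never receives everything and always gets a best set that misses one
item.

The arguments use natural weights, which reduces conflicts of incentives to integer arithmetic.
Weight zero stands for a positive value too small to affect a comparison of integers.
`isTruthfulEfficient_otherBundle` passes to weights, and `value_le_of_secures` returns to real
valuations. -/

/-- The total weight of a set of items. -/
def weight (g : ι → ℕ) (S : Finset ι) : ℕ := ∑ x ∈ S, g x

/-- The first player can always secure at least the weight of `S`. -/
def Secures [Fintype ι] [DecidableEq ι] (Z : (ι → ℕ) → (ι → ℕ) → Finset ι) (S : Finset ι) : Prop :=
  ∀ f g, weight f (Z f g) ≤ weight f Sᶜ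

/-- The same mechanism with the two players exchanged. -/
def swapPlayers [Fintype ι] [DecidableEq ι] (Z : (ι → ℕ) → (ι → ℕ) → Finset ι) :
    (ι → ℕ) → (ι → ℕ) → Finset ι :=
  fun g f => (Z f g)ᶜ

/-- `Z f g` is the bundle of the second of two players reporting the natural weights `f` and `g`;
the first player gets the complement. Weight zero models an item of negligible value. -/
structure IsTruthfulEfficient (Z : (ι → ℕ) → (ι → ℕ) → Finset ι) : Prop where
  first : ∀ f f' g, weight f (Z f g) ≤ weight f (Z f' g)
  second : ∀ f g g', weight g (Z f g') ≤ weight g (Z f g)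
  efficient : ∀ f g A, weight f A < weight f (Z f g) → weight g A ≤ weight g (Z f g)

lemma weight_singleton (g : ι → ℕ) (x : ι) : weight g {x} = g x :=
  sum_singleton g x

lemma weight_empty (g : ι → ℕ) : weight g ∅ = 0 := sum_empty

lemma weight_mono (g : ι → ℕ) {S T : Finset ι} (h : S ⊆ T) : weight g S ≤ weight g T :=
  sum_le_sum_of_subset h

lemma le_weight (g : ι → ℕ) {S : Finset ι} {x : ι} (h : x ∈ S) : g x ≤ weight g S :=
  single_le_sum (fun _ _ => Nat.zero_le _) h

lemma weight_le_of_support (g : ι → ℕ) {S T : Finset ι} (h : ∀ x ∈ S, g x ≠ 0 → x ∈ T) :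
    weight g S ≤ weight g T := by
  unfold weight
  rw [← sum_filter_ne_zero]
  apply sum_le_sum_of_subset
  intro x hx
  rw [mem_filter] at hx
  exact h x hx.1 hx.2

variable [DecidableEq ι]

lemma weight_pair (g : ι → ℕ) {x y : ι} (h : x ≠ y) : weight g {x, y} = g x + g y :=
  sum_pair h

lemma add_le_weight (g : ι → ℕ) {S : Finset ι} {x y : ι} (hx : x ∈ S) (hy : y ∈ S)
    (hxy : x ≠ y) : g x + g y ≤ weight g S := by
  rw [← weight_pair g hxy]
  exact weight_mono g (insert_subset hx (singleton_subset_iff.2 hy))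

/-- The weight concentrated on three items. -/
def threeWeight (x₁ x₂ y : ι) (p q r : ℕ) : ι → ℕ := fun x =>
  (if x = x₁ then p else 0) + (if x = x₂ then q else 0) + (if x = y then r else 0)

lemma weight_threeWeight (x₁ x₂ y : ι) (p q r : ℕ) (S : Finset ι) :
    weight (threeWeight x₁ x₂ y p q r) S =
      p * (if x₁ ∈ S then 1 else 0) + q * (if x₂ ∈ S then 1 else 0) +
        r * (if y ∈ S then 1 else 0) := by
  simp [weight, threeWeight, sum_add_distrib, sum_ite_eq']

variable {Z : (ι → ℕ) → (ι → ℕ) → Finset ι}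

/-- An exchange of `P` against `Q` cannot be strictly profitable for both players. -/
lemma IsTruthfulEfficient.exchange (hZ : IsTruthfulEfficient Z) {f g : ι → ℕ} {P Q : Finset ι}
    (hP : P ⊆ Z f g) (hQ : Disjoint Q (Z f g)) (hf : weight f Q < weight f P) :
    weight g Q ≤ weight g P := by
  have key : ∀ h : ι → ℕ,
      weight h ((Z f g \ P) ∪ Q) + weight h P = weight h (Z f g) + weight h Q := by
    intro h
    have h1 : weight h ((Z f g \ P) ∪ Q) = weight h (Z f g \ P) + weight h Q :=
      sum_union (hQ.symm.mono_left sdiff_subset)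
    have h2 : weight h (Z f g \ P) + weight h P = weight h (Z f g) := sum_sdiff hP
    omega
  have h1 := key f
  have h2 := key g
  have := hZ.efficient f g ((Z f g \ P) ∪ Q) (by omega)
  omega

lemma IsTruthfulEfficient.exchange_singleton (hZ : IsTruthfulEfficient Z) {f g : ι → ℕ} {p q : ι}
    (hp : p ∈ Z f g) (hq : q ∉ Z f g) (hf : f q < f p) : g q ≤ g p := by
  have := hZ.exchange (singleton_subset_iff.2 hp) (disjoint_singleton_left.2 hq)
  simp only [weight_singleton] at this
  exact this hf

variable [Fintype ι]

lemma weight_add_compl (g : ι → ℕ) (S : Finset ι) : weight g S + weight g Sᶜ = weight g univ :=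
  sum_add_sum_compl S g

lemma IsTruthfulEfficient.swap (hZ : IsTruthfulEfficient Z) :
    IsTruthfulEfficient (swapPlayers Z) where
  first g g' f := by
    have := hZ.second f g g'
    have := weight_add_compl g (Z f g)
    have := weight_add_compl g (Z f g')
    simp only [swapPlayers]
    omega
  second g f f' := by
    have := hZ.first f f' g
    have := weight_add_compl f (Z f g)
    have := weight_add_compl f (Z f' g)
    simp only [swapPlayers]
    omega
  efficient g f A h := by
    have := hZ.efficient f g Aᶜ
    have := weight_add_compl f (Z f g)
    have := weight_add_compl g (Z f g)
    have := weight_add_compl f A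
    have := weight_add_compl g A
    simp only [swapPlayers] at h ⊢
    omega

lemma Secures.weight_le {S : Finset ι} (h : Secures Z S) (f g : ι → ℕ) (T : Finset ι)
    (hT : ∀ x, x ∉ S → f x ≠ 0 → x ∈ T) : weight f (Z f g) ≤ weight f T :=
  (h f g).trans (weight_le_of_support f fun x hx => hT x (mem_compl.1 hx))

lemma secures_empty : Secures Z ∅ := fun f g => by
  rw [compl_empty]
  exact weight_mono f (subset_univ _)

/-- If the first player gets `S` although the second player prefers every item of `S` to
everything outside `S`, then the first player can always secure `S`. -/
lemma IsTruthfulEfficient.secures_of_disjoint (hZ : IsTruthfulEfficient Z) {S : Finset ι}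
    {f g : ι → ℕ} (hg : ∀ x ∈ S, weight g Sᶜ < g x) (hS : ∀ x ∈ S, x ∉ Z f g) : Secures Z S := by
  -- Under `e` the first player can imitate `f`, so she keeps `S` against `g`. No `g'` takes an item
  -- of `S` from `e`, since `g` would rather imitate it: one such item outweighs all of `Sᶜ`.
  -- Finally, any `f'` can imitate `e`.
  let e : ι → ℕ := fun x => if x ∈ S then 1 else 0
  have h1 : ∀ x ∈ S, x ∉ Z e g := by
    intro x hx hxZ
    have a1 := le_weight e hxZ
    have a2 := hZ.first e f g
    have a3 : weight e (Z f g) ≤ weight e ∅ := weight_le_of_support e fun y hy hy0 => by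
      by_cases hyS : y ∈ S
      · exact absurd hy (hS y hyS)
      · simp [e, hyS] at hy0
    have a4 := weight_empty e
    have a5 : e x = 1 := if_pos hx
    omega
  have h2 : ∀ g', ∀ x ∈ S, x ∉ Z e g' := by
    intro g' x hx hxZ
    have a1 := le_weight g hxZ
    have a2 := hZ.second e g g'
    have a3 : weight g (Z e g) ≤ weight g Sᶜ := weight_mono g fun y hy =>
      mem_compl.2 fun hyS => h1 y hyS hy
    have := hg x hx
    omega
  intro f' g'
  exact (hZ.first f' e g').trans
    (weight_mono f' fun y hy => mem_compl.2 fun hyS => h2 g' y hyS hy)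

lemma IsTruthfulEfficient.exists_mem_of_not_secures (hZ : IsTruthfulEfficient Z) {S : Finset ι}
    (hS : ¬ Secures Z S) (f : ι → ℕ) {g : ι → ℕ} (hg : ∀ x ∈ S, weight g Sᶜ < g x) :
    ∃ x ∈ S, x ∈ Z f g := by
  by_contra! h
  exact hS (hZ.secures_of_disjoint hg h)

/-- When both players value `x` alone, whoever receives it in that one profile secures it. -/
lemma IsTruthfulEfficient.secures_or_swapPlayers (hZ : IsTruthfulEfficient Z) (x : ι) :
    Secures Z {x} ∨ Secures (swapPlayers Z) {x} := by
  by_contra! h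
  let e : ι → ℕ := fun y => if y = x then 1 else 0
  have he : ∀ y ∈ ({x} : Finset ι), weight e {x}ᶜ < e y := by
    intro y hy
    have : weight e {x}ᶜ = 0 := sum_eq_zero fun z hz => if_neg (by simpa using hz)
    rw [this, mem_singleton.1 hy]
    simp [e]
  obtain ⟨y, hy, h1⟩ := hZ.exists_mem_of_not_secures h.1 e he
  obtain ⟨z, hz, h2⟩ := hZ.swap.exists_mem_of_not_secures h.2 e he
  rw [mem_singleton.1 hy] at h1
  rw [mem_singleton.1 hz] at h2
  exact mem_compl.1 h2 h1

/-- Two secured facets of `G` force all facets of `G` to be secured. -/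
lemma IsTruthfulEfficient.secures_erase (hZ : IsTruthfulEfficient Z) {G : Finset ι} {a b y : ι}
    (haG : a ∈ G) (hbG : b ∈ G) (hyG : y ∈ G) (hab : a ≠ b) (hay : a ≠ y) (hby : b ≠ y)
    (ha : Secures Z (G.erase a)) (hb : Secures Z (G.erase b)) : Secures Z (G.erase y) := by
  by_contra hy
  -- For `c = a, b`, securing `G.erase c` caps the loss under `f c` at 5, so within `G` only one of
  -- `c` and `y` can be lost. The conflict: against `g` the truthful report `f b` loses `b`, worth
  -- 5, while the report `f a` would lose at most `y`, worth 4.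
  let f : ι → ι → ℕ := fun c x => if x = y then 4 else if x = c then 5 else if x ∈ G then 6 else 0
  let e : ι → ℕ := fun x => if x ∈ G.erase y then 1 else 0
  let g : ι → ℕ := fun x => if x = b then 2 else if x = y then 1 else 0
  have fy : ∀ c, f c y = 4 := fun c => if_pos rfl
  have fc : ∀ c, c ≠ y → f c c = 5 := fun c hc => by simp [f, hc]
  have fG : ∀ c x, x ∈ G → x ≠ y → x ≠ c → f c x = 6 := fun c x h1 h2 h3 => by simp [f, h1, h2, h3]
  have f0 : ∀ c ∈ G, ∀ x, f c x ≠ 0 → x ∈ G := by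
    intro c hc x hx
    by_contra hxG
    have h1 : x ≠ y := fun h => hxG (h ▸ hyG)
    have h2 : x ≠ c := fun h => hxG (h ▸ hc)
    simp [f, hxG, h1, h2] at hx
  have hloss : ∀ c ∈ G, c ≠ y → Secures Z (G.erase c) → ∀ g', weight (f c) (Z (f c) g') ≤ 5 := by
    intro c hcG hcy hc g'
    have := hc.weight_le (f c) g' {c} fun x hx hx0 => by
      by_contra hxc
      rw [mem_singleton] at hxc
      exact hx (mem_erase.2 ⟨hxc, f0 c hcG x hx0⟩)
    rwa [weight_singleton, fc c hcy] at this
  have hlossb := hloss b hbG hby hb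
  have hlossa := hloss a haG hay ha
  have hbe : b ∈ Z (f b) e := by
    obtain ⟨x, hx, hxZ⟩ := hZ.exists_mem_of_not_secures hy (f b) (g := e) (by
      intro x hx
      have : weight e (G.erase y)ᶜ = 0 := sum_eq_zero fun z hz => if_neg (mem_compl.1 hz)
      rw [this]
      simp only [e, if_pos hx, zero_lt_one])
    by_cases hxb : x = b
    · exact hxb ▸ hxZ
    · have h1 := le_weight (f b) hxZ
      rw [fG b x (mem_erase.1 hx).2 (mem_erase.1 hx).1 hxb] at h1
      have := hlossb e
      omega
  have gb : g b = 2 := if_pos rfl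
  have gy : g y = 1 := by simp [g, hby.symm]
  have ga : g a = 0 := by simp [g, hab, hay]
  have hbg : b ∈ Z (f b) g := by
    by_contra hbZ
    have h1 := hZ.second (f b) g e
    have h2 := le_weight g hbe
    have h3 : weight g (Z (f b) g) ≤ weight g {y} := weight_le_of_support g fun x hx hx0 => by
      by_contra hxy
      have hxb : x ≠ b := fun h => hbZ (h ▸ hx)
      rw [mem_singleton] at hxy
      simp [g, hxy, hxb] at hx0
    rw [weight_singleton] at h3
    omega
  have hag : a ∉ Z (f a) g := by
    intro haZ
    by_cases hyZ : y ∈ Z (f a) g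
    · have h1 := add_le_weight (f a) haZ hyZ hay
      rw [fy, fc a hay] at h1
      have := hlossa g
      omega
    -- Giving `y` instead of `a` would profit both players: 4 < 5 for the first, 0 < 1 for the
    -- second.
    · have := hZ.exchange_singleton haZ hyZ (by rw [fy, fc a hay]; norm_num)
      omega
  have h1 : weight (f b) (Z (f a) g) ≤ weight (f b) {y} :=
    weight_le_of_support _ fun x hx hx0 => by
      by_contra hxy
      rw [mem_singleton] at hxy
      have h1 := le_weight (f a) hx
      rw [fG a x (f0 b hbG x hx0) hxy (fun h => hag (h ▸ hx))] at h1
      have := hlossa g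
      omega
  have h2 := hZ.first (f b) (f a) g
  have h3 := le_weight (f b) hbg
  rw [fc b hby] at h3
  rw [weight_singleton, fy] at h1
  omega

end Combinatorial

/-! ### Three items with control on both sides -/

/-- Arithmetic core of the three-item case. `A`, `B` and `C` are the indicators of the second
player's bundle of `x₁`, `x₂` and `y`, as functions of the weights of the three items for the first
and for the second player. -/
lemma three_item_impossible (A B C : ℕ → ℕ → ℕ → ℕ → ℕ → ℕ → ℕ)
    (hA : ∀ p q r s t u, A p q r s t u ≤ 1) (hB : ∀ p q r s t u, B p q r s t u ≤ 1)
    (hC : ∀ p q r s t u, C p q r s t u ≤ 1)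
    (first : ∀ p q r p' q' r' s t u,
      p * A p q r s t u + q * B p q r s t u + r * C p q r s t u ≤
        p * A p' q' r' s t u + q * B p' q' r' s t u + r * C p' q' r' s t u)
    (second : ∀ p q r s t u s' t' u',
      s * A p q r s' t' u' + t * B p q r s' t' u' + u * C p q r s' t' u' ≤
        s * A p q r s t u + t * B p q r s t u + u * C p q r s t u)
    (efficient : ∀ p q r s t u a b c, a ≤ 1 → b ≤ 1 → c ≤ 1 →
      p * a + q * b + r * c < p * A p q r s t u + q * B p q r s t u + r * C p q r s t u →
      s * a + t * b + u * c ≤ s * A p q r s t u + t * B p q r s t u + u * C p q r s t u)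
    (h₁ : ∀ p q r s t u, p * A p q r s t u + q * B p q r s t u + r * C p q r s t u ≤ q + r)
    (h₂ : ∀ p q r s t u, p * A p q r s t u + q * B p q r s t u + r * C p q r s t u ≤ p + r)
    (h₃ : ∀ p q r s t u, u ≤ s * A p q r s t u + t * B p q r s t u + u * C p q r s t u)
    (h₁₂ : (∀ p q r s t u, p * A p q r s t u + q * B p q r s t u + r * C p q r s t u ≤ r) ∨
      ∀ p q r s t u, u < s → u < t → 1 ≤ A p q r s t u + B p q r s t u) : False := by
  rcases h₁₂ with h | h
  -- Against (2, 3, 1) the report (2, 3, 4) loses exactly `x₂`, worth 3, and (1, 4, 2) loses exactly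
  -- `x₁`, worth only 2 to the type (2, 3, 4).
  · have hA1 := hA 2 3 4 0 2 1
    have hB1 := hB 2 3 4 0 2 1
    have hC1 := hC 2 3 4 0 2 1
    have a1 := h 2 3 4 0 2 1
    have a2 := h₃ 2 3 4 0 2 1
    have a3 := efficient 2 3 4 0 2 1 0 1 0
    have hA2 := hA 2 3 4 2 3 1
    have hB2 := hB 2 3 4 2 3 1
    have hC2 := hC 2 3 4 2 3 1
    have b1 := h 2 3 4 2 3 1
    have b2 := second 2 3 4 2 3 1 0 2 1
    have hA3 := hA 1 4 2 2 3 1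
    have hB3 := hB 1 4 2 2 3 1
    have hC3 := hC 1 4 2 2 3 1
    have c1 := h 1 4 2 2 3 1
    have c2 := h₃ 1 4 2 2 3 1
    have c3 := efficient 1 4 2 2 3 1 1 0 0
    have c4 := first 2 3 4 1 4 2 2 3 1
    have d1 : A 2 3 4 0 2 1 = 0 ∧ B 2 3 4 0 2 1 = 1 ∧ C 2 3 4 0 2 1 = 0 := by omega
    have d2 : A 2 3 4 2 3 1 = 0 ∧ B 2 3 4 2 3 1 = 1 ∧ C 2 3 4 2 3 1 = 0 := by omega
    have d3 : A 1 4 2 2 3 1 = 1 ∧ B 1 4 2 2 3 1 = 0 ∧ C 1 4 2 2 3 1 = 0 := by omega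
    omega
  -- Against (2, 2, 1), the type (4, 2, 1) loses `x₂` but not `x₁`, and (2, 4, 1) loses `x₁` but not
  -- `x₂`. The four cases record whether `y` is lost as well.
  · have hA1 := hA 4 2 1 2 2 1
    have hB1 := hB 4 2 1 2 2 1
    have a1 := h₁ 4 2 1 2 2 1
    have a2 := h 4 2 1 2 2 1 (by norm_num) (by norm_num)
    have hA2 := hA 2 4 1 2 2 1
    have hB2 := hB 2 4 1 2 2 1
    have b1 := h₂ 2 4 1 2 2 1
    have b2 := h 2 4 1 2 2 1 (by norm_num) (by norm_num)
    have hC1 := hC 4 2 1 2 2 1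
    have hC2 := hC 2 4 1 2 2 1
    have a3 : A 4 2 1 2 2 1 = 0 ∧ B 4 2 1 2 2 1 = 1 := by omega
    have b3 : A 2 4 1 2 2 1 = 1 ∧ B 2 4 1 2 2 1 = 0 := by omega
    obtain ⟨eA1, eB1⟩ := a3
    obtain ⟨eA2, eB2⟩ := b3
    clear hA1 hB1 hA2 hB2 a1 a2 b1 b2
    obtain eC1 | eC1 : C 4 2 1 2 2 1 = 0 ∨ C 4 2 1 2 2 1 = 1 := by omega
    · obtain eC2 | eC2 : C 2 4 1 2 2 1 = 0 ∨ C 2 4 1 2 2 1 = 1 := by omega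
      -- Neither loses `y`. Against (0, 3, 2) the type (4, 2, 1) loses `x₂`, worth 2, but by
      -- reporting (2, 4, 1) would lose only `y`, worth 1.
      · clear hC1 hC2
        have c1 := second 4 2 1 0 3 2 2 2 1
        have c2 := second 4 2 1 2 2 1 0 3 2
        have c3 := h₁ 4 2 1 0 3 2
        have d1 := second 2 4 1 2 2 1 0 3 2
        have d2 := h₂ 2 4 1 0 3 2
        have d3 := h₃ 2 4 1 0 3 2
        have d4 := first 4 2 1 2 4 1 0 3 2
        have := hA 4 2 1 0 3 2
        have := hB 4 2 1 0 3 2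
        have := hC 4 2 1 0 3 2
        have := hA 2 4 1 0 3 2
        have := hB 2 4 1 0 3 2
        have := hC 2 4 1 0 3 2
        rw [eA1, eB1, eC1] at c1 c2
        rw [eA2, eB2, eC2] at d1
        have : A 4 2 1 0 3 2 = 0 ∧ B 4 2 1 0 3 2 = 1 ∧ C 4 2 1 0 3 2 = 0 := by omega
        have : A 2 4 1 0 3 2 = 0 ∧ B 2 4 1 0 3 2 = 0 ∧ C 2 4 1 0 3 2 = 1 := by omega
        omega
      -- The type (3, 4, 2) loses `x₁` and `y` against (3, 0, 2). Against (2, 2, 1) its loss is at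
      -- most 4, by imitating (4, 2, 1); yet the second player can secure 3 there by reporting (3,
      -- 0, 2), which needs two items and costs at least 5.
      · clear hC1 hC2
        have c1 := second 2 4 1 3 0 2 2 2 1
        have c2 := h₂ 2 4 1 3 0 2
        have d1 := h₁ 4 2 1 3 0 2
        have d2 := h₃ 4 2 1 3 0 2
        have d3 := first 2 4 1 4 2 1 3 0 2
        have := hA 4 2 1 3 0 2
        have := hB 4 2 1 3 0 2
        have := hC 4 2 1 3 0 2
        have := hA 2 4 1 3 0 2
        have := hB 2 4 1 3 0 2
        have := hC 2 4 1 3 0 2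
        have f1 := first 3 4 2 2 4 1 3 0 2
        have f2 := first 2 4 1 3 4 2 3 0 2
        have f3 := first 4 2 1 3 4 2 3 0 2
        have := hA 3 4 2 3 0 2
        have := hB 3 4 2 3 0 2
        have := hC 3 4 2 3 0 2
        have k1 := first 3 4 2 4 2 1 2 2 1
        have k2 := second 3 4 2 2 2 1 3 0 2
        have := hA 3 4 2 2 2 1
        have := hB 3 4 2 2 2 1
        have := hC 3 4 2 2 2 1
        rw [eA2, eB2, eC2] at c1
        rw [eA1, eB1, eC1] at k1
        have : A 2 4 1 3 0 2 = 1 ∧ B 2 4 1 3 0 2 = 0 ∧ C 2 4 1 3 0 2 = 1 := by omega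
        have : A 4 2 1 3 0 2 = 0 ∧ B 4 2 1 3 0 2 = 1 ∧ C 4 2 1 3 0 2 = 1 := by omega
        have : A 3 4 2 3 0 2 = 1 ∧ B 3 4 2 3 0 2 = 0 ∧ C 3 4 2 3 0 2 = 1 := by omega
        omega
    · obtain eC2 | eC2 : C 2 4 1 2 2 1 = 0 ∨ C 2 4 1 2 2 1 = 1 := by omega
      -- The previous case with `x₁` and `x₂` interchanged.
      · clear hC1 hC2
        have c1 := second 4 2 1 0 3 2 2 2 1
        have c2 := h₁ 4 2 1 0 3 2
        have d1 := h₂ 2 4 1 0 3 2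
        have d2 := h₃ 2 4 1 0 3 2
        have d3 := first 4 2 1 2 4 1 0 3 2
        have := hA 4 2 1 0 3 2
        have := hB 4 2 1 0 3 2
        have := hC 4 2 1 0 3 2
        have := hA 2 4 1 0 3 2
        have := hB 2 4 1 0 3 2
        have := hC 2 4 1 0 3 2
        have f1 := first 4 3 2 4 2 1 0 3 2
        have f2 := first 2 4 1 4 3 2 0 3 2
        have f3 := first 4 2 1 4 3 2 0 3 2
        have := hA 4 3 2 0 3 2
        have := hB 4 3 2 0 3 2
        have := hC 4 3 2 0 3 2
        have k1 := first 4 3 2 2 4 1 2 2 1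
        have k2 := second 4 3 2 2 2 1 0 3 2
        have := hA 4 3 2 2 2 1
        have := hB 4 3 2 2 2 1
        have := hC 4 3 2 2 2 1
        rw [eA1, eB1, eC1] at c1
        rw [eA2, eB2, eC2] at k1
        have : A 4 2 1 0 3 2 = 0 ∧ B 4 2 1 0 3 2 = 1 ∧ C 4 2 1 0 3 2 = 1 := by omega
        have : A 2 4 1 0 3 2 = 1 ∧ B 2 4 1 0 3 2 = 0 ∧ C 2 4 1 0 3 2 = 1 := by omega
        have : A 4 3 2 0 3 2 = 0 ∧ B 4 3 2 0 3 2 = 1 ∧ C 4 3 2 0 3 2 = 1 := by omega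
        omega
      -- Both lose `y`. Against (4, 2, 1) the type (4, 3, 3) is forced to lose `x₂` and `y`; trading
      -- these for `x₁` profits both players.
      · clear hC1 hC2
        have c1 := h₁ 4 2 1 4 2 1
        have c2 := second 4 2 1 4 2 1 2 2 1
        have d1 := h₂ 2 4 1 4 2 1
        have d2 := second 2 4 1 4 2 1 2 2 1
        have := hA 4 2 1 4 2 1
        have := hB 4 2 1 4 2 1
        have := hC 4 2 1 4 2 1
        have := hA 2 4 1 4 2 1
        have := hB 2 4 1 4 2 1
        have := hC 2 4 1 4 2 1
        have k1 := h₁ 4 3 3 4 2 1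
        have k2 := h 4 3 3 4 2 1 (by norm_num) (by norm_num)
        have k3 := first 4 2 1 4 3 3 4 2 1
        have k4 := first 2 4 1 4 3 3 4 2 1
        have k5 := efficient 4 3 3 4 2 1 1 0 0
        have := hA 4 3 3 4 2 1
        have := hB 4 3 3 4 2 1
        have := hC 4 3 3 4 2 1
        rw [eA1, eB1, eC1] at c2
        rw [eA2, eB2, eC2] at d2
        have : A 4 2 1 4 2 1 = 0 ∧ B 4 2 1 4 2 1 = 1 ∧ C 4 2 1 4 2 1 = 1 := by omega
        have : A 2 4 1 4 2 1 = 1 ∧ B 2 4 1 4 2 1 = 0 ∧ C 2 4 1 4 2 1 = 1 := by omega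
        obtain eA3 | eA3 : A 4 3 3 4 2 1 = 0 ∨ A 4 3 3 4 2 1 = 1 := by omega
        all_goals omega

section Combinatorial

variable {ι : Type*} [DecidableEq ι] [Fintype ι] {Z : (ι → ℕ) → (ι → ℕ) → Finset ι}

/-- With at least three items, the two players cannot both control single items. -/
lemma IsTruthfulEfficient.three_items (hZ : IsTruthfulEfficient Z) {x₁ x₂ y : ι} (h12 : x₁ ≠ x₂)
    (h1y : x₁ ≠ y) (h2y : x₂ ≠ y) (h₁ : Secures Z {x₁}) (h₂ : Secures Z {x₂})
    (h₃ : Secures (swapPlayers Z) {y}) : False := by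
  let t := threeWeight x₁ x₂ y
  let ind : ι → ℕ → ℕ → ℕ → ℕ → ℕ → ℕ → ℕ := fun x p q r s u v =>
    if x ∈ Z (t p q r) (t s u v) then 1 else 0
  have ind_le : ∀ x p q r s u v, ind x p q r s u v ≤ 1 := by
    intro x p q r s u v
    simp only [ind]
    split_ifs <;> norm_num
  have hw : ∀ p q r S, weight (t p q r) S = p * (if x₁ ∈ S then 1 else 0) +
      q * (if x₂ ∈ S then 1 else 0) + r * (if y ∈ S then 1 else 0) :=
    weight_threeWeight x₁ x₂ y
  refine three_item_impossible (ind x₁) (ind x₂) (ind y) (ind_le x₁) (ind_le x₂) (ind_le y)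
    ?_ ?_ ?_ ?_ ?_ ?_ ?_
  · intro p q r p' q' r' s u v
    have := hZ.first (t p q r) (t p' q' r') (t s u v)
    rwa [hw, hw] at this
  · intro p q r s u v s' u' v'
    have := hZ.second (t p q r) (t s u v) (t s' u' v')
    rwa [hw, hw] at this
  · intro p q r s u v a b c ha hb hc
    have := hZ.efficient (t p q r) (t s u v)
      ((if a = 1 then {x₁} else ∅) ∪ (if b = 1 then {x₂} else ∅) ∪ (if c = 1 then {y} else ∅))
    rw [hw, hw, hw, hw] at this
    interval_cases a <;> interval_cases b <;> interval_cases c <;>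
      simp [h12, h1y, h2y, h12.symm, h1y.symm, h2y.symm] at this ⊢ <;>
      simpa [ind] using this
  · intro p q r s u v
    have := h₁ (t p q r) (t s u v)
    rw [hw, hw] at this
    simpa [ind, h12, h1y, h2y, h12.symm, h1y.symm, h2y.symm] using this
  · intro p q r s u v
    have := h₂ (t p q r) (t s u v)
    rw [hw, hw] at this
    simpa [ind, h12, h1y, h2y, h12.symm, h1y.symm, h2y.symm] using this
  · intro p q r s u v
    have h := h₃ (t s u v) (t p q r)
    have h' := weight_add_compl (t s u v) (Z (t p q r) (t s u v))
    have h'' := weight_add_compl (t s u v) {y}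
    have e : weight (t s u v) {y} = v := by rw [hw]; simp [h1y, h2y]
    have := hw s u v (Z (t p q r) (t s u v))
    simp only [swapPlayers] at h
    simp only [ind]
    omega
  -- If the pair is not secured, a second player who prefers each of its items to `y` receives one
  -- of them.
  · by_cases h : Secures Z {x₁, x₂}
    · left
      intro p q r s u v
      have := h (t p q r) (t s u v)
      rw [hw, hw] at this
      simpa [ind, h1y.symm, h2y.symm] using this
    · right
      intro p q r s u v hs hu
      obtain ⟨x, hx, hxZ⟩ := hZ.exists_mem_of_not_secures h (t p q r) (g := t s u v) (by
        intro x hx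
        rw [hw]
        rw [mem_insert, mem_singleton] at hx
        rcases hx with rfl | rfl
        · simp [t, threeWeight, h12, h1y, h12.symm, h1y.symm, h2y.symm, hs]
        · simp [t, threeWeight, h12, h2y, h12.symm, h1y.symm, h2y.symm, hu])
      rw [mem_insert, mem_singleton] at hx
      rcases hx with rfl | rfl
      · simp [ind, hxZ]
      · simp [ind, hxZ]

end Combinatorial

end TwoPlayer

namespace TwoPlayer

open Finset

/-! ### From single items to all proper subsets -/

section Combinatorial

variable {ι : Type*} [DecidableEq ι]

/-- Weights `a` and `b` on the items `z₀` and `z₁`, weight `d` on `r`, weight `c` on the rest of `R`,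
and weight zero elsewhere. -/
def blockWeight (R : Finset ι) (z₀ z₁ r : ι) (a b c d : ℕ) : ι → ℕ := fun x =>
  if x = z₀ then a else if x = z₁ then b else if x = r then d else if x ∈ R then c else 0

variable [Fintype ι] {Z : (ι → ℕ) → (ι → ℕ) → Finset ι}

/-- If `R` and all its modifications by exchanging one item for `z₀` are secured, then
`R ∪ {z₀}` or `R ∪ {z₁}` is secured. -/
lemma IsTruthfulEfficient.secures_insert_or (hZ : IsTruthfulEfficient Z) {R : Finset ι} {z₀ z₁ : ι}
    (h01 : z₀ ≠ z₁) (h0 : z₀ ∉ R) (h1 : z₁ ∉ R) (hR : R.Nonempty) (hRs : Secures Z R)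
    (hRe : ∀ r ∈ R, Secures Z (insert z₀ (R.erase r))) :
    Secures Z (insert z₀ R) ∨ Secures Z (insert z₁ R) := by
  by_contra! hcon
  obtain ⟨hn0, hn1⟩ := hcon
  let W := blockWeight R z₀ z₁
  have W0 : ∀ r a b c d, W r a b c d z₀ = a := fun r a b c d => if_pos rfl
  have W1 : ∀ r a b c d, W r a b c d z₁ = b := fun r a b c d => by
    simp [W, blockWeight, h01.symm]
  have Wr : ∀ r ∈ R, ∀ a b c d, W r a b c d r = d := fun r hr a b c d => by
    have h2 : r ≠ z₀ := fun h => h0 (h ▸ hr)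
    have h3 : r ≠ z₁ := fun h => h1 (h ▸ hr)
    simp [W, blockWeight, h2, h3]
  have WR : ∀ r, ∀ x ∈ R, x ≠ r → ∀ a b c d, W r a b c d x = c := fun r x hx hxr a b c d => by
    have h2 : x ≠ z₀ := fun h => h0 (h ▸ hx)
    have h3 : x ≠ z₁ := fun h => h1 (h ▸ hx)
    simp [W, blockWeight, h2, h3, hx, hxr]
  have WR' : ∀ r, ∀ x ∈ R, ∀ a b c, W r a b c c x = c := fun r x hx a b c => by
    by_cases hxr : x = r
    · subst hxr; exact Wr x hx _ _ _ _
    · exact WR r x hx hxr _ _ _ _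
  have Wsupp : ∀ r ∈ R, ∀ a b c d x, W r a b c d x ≠ 0 → x = z₀ ∨ x = z₁ ∨ x ∈ R := by
    intro r hr a b c d x hx
    by_contra! h
    have h2 : x ≠ r := fun h2 => h.2.2 (h2 ▸ hr)
    simp [W, blockWeight, h, h2] at hx
  have loss : ∀ r ∈ R, ∀ a b c d g, weight (W r a b c d) (Z (W r a b c d) g) ≤ a + b := by
    intro r hr a b c d g
    have := hRs.weight_le (W r a b c d) g {z₀, z₁} fun x hx hx0 => by
      rcases Wsupp r hr a b c d x hx0 with h | h | h
      · simp [h]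
      · simp [h]
      · exact absurd h hx
    rwa [weight_pair _ h01, W0, W1] at this
  have loss' : ∀ r ∈ R, ∀ a b c d g, weight (W r a b c d) (Z (W r a b c d) g) ≤ d + b := by
    intro r hr a b c d g
    have hr1 : r ≠ z₁ := fun h => h1 (h ▸ hr)
    have := (hRe r hr).weight_le (W r a b c d) g {r, z₁} fun x hx hx0 => by
      rw [mem_insert, mem_erase] at hx
      rw [mem_insert, mem_singleton]
      rcases Wsupp r hr a b c d x hx0 with h | h | h
      · exact absurd (Or.inl h) hx
      · exact Or.inr h
      · by_contra hne
        exact hx (Or.inr ⟨fun h' => hne (Or.inl h'), h⟩)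
    rwa [weight_pair _ hr1, Wr r hr, W1] at this
  obtain ⟨r₀, hr₀⟩ := hR
  let f := W r₀ 2 1 4 4
  have f0 : f z₀ = 2 := W0 ..
  have f1 : f z₁ = 1 := W1 ..
  -- Securing `R` caps the loss under `f` at 2 + 1, less than the weight 4 of an item of `R`. The
  -- proof splits on whether `f` can ever lose both `z₀` and `z₁`.
  have fdis : ∀ g, ∀ x ∈ R, x ∉ Z f g := by
    intro g x hx hxZ
    have a1 := loss r₀ hr₀ 2 1 4 4 g
    have a2 := le_weight f hxZ
    have a3 : f x = 4 := WR' r₀ x hx _ _ _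
    change weight f (Z f g) ≤ _ at a1
    omega
  by_cases hboth : ∃ g, z₀ ∈ Z f g ∧ z₁ ∈ Z f g
  · obtain ⟨g, hg0, hg1⟩ := hboth
    have fall : ∀ r ∈ R, ∀ a b c d, 0 < a → 0 < b →
        z₀ ∈ Z f (W r a b c d) ∧ z₁ ∈ Z f (W r a b c d) := by
      intro r hr a b c d ha hb
      have k1 := hZ.second f (W r a b c d) g
      have k2 := add_le_weight (W r a b c d) hg0 hg1 h01
      rw [W0, W1] at k2
      have k3 : ∀ y, (∀ x ∈ Z f (W r a b c d), W r a b c d x ≠ 0 → x = y) →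
          weight (W r a b c d) (Z f (W r a b c d)) ≤ W r a b c d y := by
        intro y hy
        rw [← weight_singleton (W r a b c d) y]
        exact weight_le_of_support _ fun x hx hx0 => mem_singleton.2 (hy x hx hx0)
      constructor
      · by_contra hz
        have := k3 z₁ fun x hx hx0 => by
          rcases Wsupp r hr a b c d x hx0 with h | h | h
          · exact absurd (h ▸ hx) hz
          · exact h
          · exact absurd hx (fdis _ x h)
        rw [W1] at this
        omega
      · by_contra hz
        have := k3 z₀ fun x hx hx0 => by
          rcases Wsupp r hr a b c d x hx0 with h | h | h
          · exact h
          · exact absurd (h ▸ hx) hz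
          · exact absurd hx (fdis _ x h)
        rw [W0] at this
        omega
    -- Otherwise the type `f`, which loses both `z₀` and `z₁` by `fall`, would imitate `f'` and lose
    -- at most one of them.
    have star : ∀ r ∈ R, ∀ a b c d, 0 < a → 0 < b → ∀ f',
        (z₀ ∈ Z f' (W r a b c d) ∧ z₁ ∈ Z f' (W r a b c d)) ∨
          ∃ x ∈ R, x ∈ Z f' (W r a b c d) := by
      intro r hr a b c d ha hb f'
      by_contra! hne
      obtain ⟨hne, hdis⟩ := hne
      have k1 := hZ.first f f' (W r a b c d)
      obtain ⟨m0, m1⟩ := fall r hr a b c d ha hb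
      have k2 := add_le_weight f m0 m1 h01
      by_cases hz : z₀ ∈ Z f' (W r a b c d)
      · have k3 : weight f (Z f' (W r a b c d)) ≤ weight f {z₀} :=
          weight_le_of_support _ fun x hx hx0 => by
            rcases Wsupp r₀ hr₀ _ _ _ _ x hx0 with h | h | h
            · exact mem_singleton.2 h
            · exact absurd (h ▸ hx) (hne hz)
            · exact absurd hx (hdis x h)
        rw [weight_singleton] at k3
        omega
      · have k3 : weight f (Z f' (W r a b c d)) ≤ weight f {z₁} :=
          weight_le_of_support _ fun x hx hx0 => by
            rcases Wsupp r₀ hr₀ _ _ _ _ x hx0 with h | h | h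
            · exact absurd (h ▸ hx) hz
            · exact mem_singleton.2 h
            · exact absurd hx (hdis x h)
        rw [weight_singleton] at k3
        omega
    have only : ∀ g, ∀ r ∈ R, ∀ r' ∈ R, r ∈ Z (W r' 12 10 14 14) g →
        ∀ x, x = z₀ ∨ x = z₁ ∨ x ∈ R → x ∈ Z (W r' 12 10 14 14) g → x = r := by
      intro g r hr r' hr' hrZ x hx hxZ
      by_contra hxr
      have k1 := loss r' hr' 12 10 14 14 g
      have k2 := add_le_weight (W r' 12 10 14 14) hrZ hxZ (Ne.symm hxr)
      rw [WR' r' r hr] at k2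
      rcases hx with h | h | h
      · subst h; rw [W0] at k2; omega
      · subst h; rw [W1] at k2; omega
      · rw [WR' r' x h] at k2; omega
    obtain ⟨r, hr, hrZ⟩ : ∃ r ∈ R, r ∈ Z (W r₀ 12 10 14 14) (W r₀ 1 1 3 3) := by
      rcases star r₀ hr₀ 1 1 3 3 one_pos one_pos (W r₀ 12 10 14 14) with ⟨m0, m1⟩ | h
      · by_contra! hdis
        have k := hZ.exchange (P := {z₀, z₁}) (Q := {r₀})
          (insert_subset m0 (singleton_subset_iff.2 m1)) (disjoint_singleton_left.2 (hdis r₀ hr₀))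
        rw [weight_pair _ h01, weight_pair _ h01, weight_singleton, weight_singleton, W0, W0, W1,
          W1, Wr r₀ hr₀, Wr r₀ hr₀] at k
        omega
      · exact h
    have Wconst : ∀ a b c, W r₀ a b c c = W r a b c c := by
      intro a b c
      funext x
      by_cases hx : x = z₀ ∨ x = z₁ ∨ x ∈ R
      · rcases hx with h | h | h
        · rw [h, W0, W0]
        · rw [h, W1, W1]
        · rw [WR' _ x h, WR' _ x h]
      · have k1 := mt (Wsupp r hr a b c c x) hx
        have k2 := mt (Wsupp r₀ hr₀ a b c c x) hx
        push Not at k1 k2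
        rw [k1, k2]
    rw [Wconst, Wconst] at hrZ
    -- `c'` lowers the weight of `r` so that the pair `r`, `z₁` costs 21, just below the 22 of `z₀`,
    -- `z₁`. Against `g₁`, `c'` loses `r` but neither `z₀` nor `z₁`, so the second player gets 3.
    -- Against `g₂`, it loses both `r` and `z₁`, worth 4 under `g₁`: the second player would
    -- misreport.
    let c := W r 12 10 14 14
    let c' := W r 12 10 14 11
    let g₁ := W r 1 1 3 3
    let g₂ := W r 3 1 0 2
    have hr0 : r ≠ z₀ := fun h => h0 (h ▸ hr)
    have hr1 : r ≠ z₁ := fun h => h1 (h ▸ hr)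
    have cr : c r = 14 := Wr r hr ..
    have c0 : c z₀ = 12 := W0 ..
    have cr' : c' r = 11 := Wr r hr ..
    have c0' : c' z₀ = 12 := W0 ..
    have c1' : c' z₁ = 10 := W1 ..
    have cR' : ∀ x ∈ R, x ≠ r → c' x = 14 := fun x hx hxr => WR r x hx hxr ..
    have g1r : g₁ r = 3 := Wr r hr ..
    have g11 : g₁ z₁ = 1 := W1 ..
    have g2r : g₂ r = 2 := Wr r hr ..
    have g20 : g₂ z₀ = 3 := W0 ..
    have g2R : ∀ x ∈ R, x ≠ r → g₂ x = 0 := fun x hx hxr => WR r x hx hxr ..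
    have hc1 : weight c' (Z c' g₁) ≤ 11 := by
      have k1 := hZ.first c' c g₁
      have k2 : weight c' (Z c g₁) ≤ weight c' {r} := weight_le_of_support _ fun x hx hx0 =>
        mem_singleton.2 (only g₁ r hr r hr hrZ x (Wsupp r hr _ _ _ _ x hx0) hx)
      rw [weight_singleton] at k2
      omega
    have m0 : z₀ ∉ Z c' g₁ := fun h => by
      have := le_weight c' h
      omega
    have mR : ∀ x ∈ R, x ∈ Z c' g₁ → x = r := by
      intro x hx hxZ
      by_contra hxr
      have := le_weight c' hxZ
      have := cR' x hx hxr
      omega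
    have mr : r ∈ Z c' g₁ := by
      rcases star r hr 1 1 3 3 one_pos one_pos c' with h | ⟨x, hx, hxZ⟩
      · exact absurd h.1 m0
      · exact mR x hx hxZ ▸ hxZ
    have m1 : z₁ ∉ Z c' g₁ := fun h => by
      have := add_le_weight c' mr h hr1
      omega
    have hg1 : weight g₁ (Z c' g₁) ≤ 3 := by
      have : weight g₁ (Z c' g₁) ≤ weight g₁ {r} := weight_le_of_support _ fun x hx hx0 => by
        rw [mem_singleton]
        rcases Wsupp r hr _ _ _ _ x hx0 with h | h | h
        · exact absurd (h ▸ hx) m0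
        · exact absurd (h ▸ hx) m1
        · exact mR x h hx
      rwa [weight_singleton, g1r] at this
    have hct : 22 ≤ weight c (Z c g₂) := by
      rcases star r hr 3 1 0 2 (by norm_num) one_pos c with ⟨n0, n1⟩ | ⟨x, hx, hxZ⟩
      · have : c z₀ + c z₁ ≤ weight c (Z c g₂) := add_le_weight c n0 n1 h01
        have c1 : c z₁ = 10 := W1 ..
        omega
      · exfalso
        have k1 := hZ.second c g₂ g₁
        have k2 : g₂ r ≤ weight g₂ (Z c g₁) := le_weight g₂ hrZ
        have k3 : weight g₂ (Z c g₂) ≤ weight g₂ {x} := weight_le_of_support _ fun y hy hy0 =>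
          mem_singleton.2 (only g₂ x hx r hr hxZ y (Wsupp r hr _ _ _ _ y hy0) hy)
        rw [weight_singleton] at k3
        have hxr : x = r := by
          by_contra hxr
          have := g2R x hx hxr
          omega
        subst hxr
        have n0 : z₀ ∉ Z c g₂ := fun h => hr0 (only g₂ x hx x hx hxZ z₀ (Or.inl rfl) h).symm
        have : g₂ z₀ ≤ g₂ x := hZ.exchange_singleton hxZ n0 (show c z₀ < c x by omega)
        omega
    have hl : weight c' (Z c' g₂) ≤ 21 := loss' r hr 12 10 14 11 g₂
    have hc2 := hZ.first c c' g₂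
    have hg2 := hZ.second c' g₂ g₁
    have hg2' := le_weight g₂ mr
    obtain ⟨x, hx, hxZ⟩ : ∃ x ∈ R, x ∈ Z c' g₂ := by
      rcases star r hr 3 1 0 2 (by norm_num) one_pos c' with ⟨n0, n1⟩ | h
      · have : c' z₀ + c' z₁ ≤ weight c' (Z c' g₂) := add_le_weight c' n0 n1 h01
        omega
      · exact h
    have hxr : x = r := by
      by_contra hxr
      have k1 := cR' x hx hxr
      have k2 : weight g₂ (Z c' g₂) ≤ weight g₂ {x} := weight_le_of_support _ fun y hy hy0 => by
        rw [mem_singleton]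
        by_contra hyx
        have k3 := add_le_weight c' hxZ hy (Ne.symm hyx)
        rcases Wsupp r hr _ _ _ _ y hy0 with h | h | h
        · subst h; omega
        · subst h; omega
        · by_cases hyr : y = r
          · subst hyr; omega
          · exact hy0 (g2R y h hyr)
      rw [weight_singleton, g2R x hx hxr] at k2
      omega
    subst hxr
    have n1 : z₁ ∈ Z c' g₂ := by
      by_contra n1
      have k2 : weight c (Z c' g₂) ≤ weight c {x} := weight_le_of_support _ fun y hy hy0 => by
        rw [mem_singleton]
        by_contra hyx
        have k3 := add_le_weight c' hxZ hy (Ne.symm hyx)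
        rcases Wsupp x hr _ _ _ _ y hy0 with h | h | h
        · subst h; omega
        · exact n1 (h ▸ hy)
        · have := cR' y h hyx
          omega
      rw [weight_singleton] at k2
      omega
    have k1 := hZ.second c' g₁ g₂
    have k2 := add_le_weight g₁ hxZ n1 hr1
    omega
  · push Not at hboth
    -- Here `f` loses `z₁` to `a`, hence to `g`, and never `z₀` with it. By imitating `f`, `h` loses
    -- at most 1 against `g`, leaving that player at most 2. Reporting `g'` instead would win an
    -- item of `R`, worth 4 under `g`.
    let a := W r₀ 0 2 1 1
    let g := W r₀ 1 2 4 4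
    let g' := W r₀ 2 1 4 4
    let h := W r₀ 4 1 2 2
    have ma : z₁ ∈ Z f a := by
      obtain ⟨x, hx, hxZ⟩ := hZ.exists_mem_of_not_secures hn1 f (g := a) (by
        intro x hx
        have k1 : weight a (insert z₁ R)ᶜ ≤ weight a ∅ := weight_le_of_support _ fun y hy hy0 => by
          exfalso
          rw [mem_compl, mem_insert] at hy
          rcases Wsupp r₀ hr₀ _ _ _ _ y hy0 with h | h
          · subst h; exact hy0 (W0 ..)
          · exact hy h
        rw [weight_empty] at k1
        have k2 : 0 < a x := by
          rcases mem_insert.1 hx with h | h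
          · rw [h]; exact two_pos.trans_eq (W1 r₀ 0 2 1 1).symm
          · exact one_pos.trans_eq (WR' r₀ x h 0 2 1).symm
        omega)
      rcases mem_insert.1 hx with h | h
      · exact h ▸ hxZ
      · exact absurd hxZ (fdis a x h)
    have mg : z₁ ∈ Z f g := by
      by_contra hz
      have k1 := hZ.second f g a
      have k2 := le_weight g ma
      have k3 : weight g (Z f g) ≤ weight g {z₀} := weight_le_of_support _ fun x hx hx0 => by
        rcases Wsupp r₀ hr₀ _ _ _ _ x hx0 with h | h | h
        · exact mem_singleton.2 h
        · exact absurd (h ▸ hx) hz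
        · exact absurd hx (fdis g x h)
      have k4 : g z₁ = 2 := W1 ..
      have k5 : g z₀ = 1 := W0 ..
      rw [weight_singleton] at k3
      omega
    have hh1 : h z₁ = 1 := W1 ..
    have hh0 : h z₀ = 4 := W0 ..
    have hhR : ∀ x ∈ R, h x = 2 := fun x hx => WR' r₀ x hx ..
    have hhg : weight h (Z h g) ≤ 1 := by
      have k1 := hZ.first h f g
      have k2 : weight h (Z f g) ≤ weight h {z₁} := weight_le_of_support _ fun x hx hx0 => by
        rcases Wsupp r₀ hr₀ _ _ _ _ x hx0 with h | h | h
        · exact absurd mg (hboth g (h ▸ hx))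
        · exact mem_singleton.2 h
        · exact absurd hx (fdis g x h)
      rw [weight_singleton] at k2
      omega
    have hgg : weight g (Z h g) ≤ weight g {z₁} := weight_le_of_support _ fun x hx hx0 => by
      have k1 := le_weight h hx
      rcases Wsupp r₀ hr₀ _ _ _ _ x hx0 with h' | h' | h'
      · subst h'; omega
      · exact mem_singleton.2 h'
      · have := hhR x h'
        omega
    obtain ⟨x, hx, hxZ⟩ := hZ.exists_mem_of_not_secures hn0 h (g := g') (by
      intro x hx
      have k1 : weight g' (insert z₀ R)ᶜ ≤ weight g' {z₁} :=
        weight_le_of_support _ fun y hy hy0 => by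
          rw [mem_compl, mem_insert] at hy
          rcases Wsupp r₀ hr₀ _ _ _ _ y hy0 with h | h | h
          · exact absurd (Or.inl h) hy
          · exact mem_singleton.2 h
          · exact absurd (Or.inr h) hy
      have k2 : g' z₁ = 1 := W1 ..
      have k3 : 2 ≤ g' x := by
        rcases mem_insert.1 hx with h | h
        · rw [h]; exact (W0 r₀ 2 1 4 4).ge
        · have : g' x = 4 := WR' r₀ x h ..
          omega
      rw [weight_singleton] at k1
      omega)
    have hl : weight h (Z h g') ≤ 3 := loss' r₀ hr₀ 4 1 2 2 g'
    have hle := le_weight h hxZ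
    rcases mem_insert.1 hx with h' | h'
    · subst h'; omega
    · have k1 := hZ.second h g g'
      have k2 := le_weight g hxZ
      have k3 : g x = 4 := WR' r₀ x h' ..
      have k4 : g z₁ = 2 := W1 ..
      rw [weight_singleton] at hgg
      omega

/-- If every single item is secured, then so is every proper subset. -/
lemma IsTruthfulEfficient.secures_of_ne_univ (hZ : IsTruthfulEfficient Z)
    (hs : ∀ x, Secures Z {x}) : ∀ (k : ℕ) (S : Finset ι), S.card = k → S ≠ univ → Secures Z S
  | 0, S, hS, _ => by
    rw [card_eq_zero.1 hS]
    exact secures_empty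
  | 1, S, hS, _ => by
    obtain ⟨x, rfl⟩ := card_eq_one.1 hS
    exact hs x
  | k + 2, S, hS, hne => by
    have ih := hZ.secures_of_ne_univ hs (k + 1)
    by_contra hcon
    obtain ⟨y, hy⟩ : ∃ y, y ∉ S := by
      by_contra! h
      exact hne (eq_univ_iff_forall.2 h)
    have hstep : ∀ z ∈ S, Secures Z (insert y (S.erase z)) := by
      intro z hz
      have hyz : y ≠ z := fun h => hy (h ▸ hz)
      have hcard : (S.erase z).card = k + 1 := by rw [card_erase_of_mem hz, hS]; rfl
      have hz1 : z ∉ S.erase z := notMem_erase z S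
      have hy1 : y ∉ S.erase z := fun h => hy (mem_of_mem_erase h)
      -- With `R = S.erase z`, the second alternative is `S` itself, so the first must hold. Thus
      -- every facet of `insert y S` other than `S` is secured, and two of them force `S`.
      rcases hZ.secures_insert_or hyz hy1 hz1 (card_pos.1 (by omega))
        (ih _ hcard fun h => hz1 (h ▸ mem_univ z)) (by
          intro r hr
          refine ih _ ?_ fun h => ?_
          · rw [card_insert_of_notMem fun h => hy1 (mem_of_mem_erase h), card_erase_of_mem hr,
              hcard]
            rfl
          · have := h ▸ mem_univ z
            simp [hyz.symm] at this) with h | h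
      · exact h
      · rw [insert_erase hz] at h
        exact absurd h hcon
    obtain ⟨a, ha, b, hb, hab⟩ := one_lt_card.1 (show 1 < S.card by omega)
    have e : ∀ z ∈ S, (insert y S).erase z = insert y (S.erase z) := fun z hz =>
      erase_insert_of_ne fun h => hy (h ▸ hz)
    have := hZ.secures_erase (G := insert y S) (a := a) (b := b) (y := y)
      (mem_insert_of_mem ha) (mem_insert_of_mem hb) (mem_insert_self y S) hab
      (fun h => hy (h ▸ ha)) (fun h => hy (h ▸ hb)) ((e a ha).symm ▸ hstep a ha)
      ((e b hb).symm ▸ hstep b hb)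
    rw [erase_insert hy] at this
    exact hcon this

end Combinatorial

end TwoPlayer

namespace TwoPlayer

open Finset

/-! ### Between natural weights and real valuations -/

variable {m : ℕ}

lemma Valuation.value_add_compl (w : Valuation m) (S : Finset (Fin m)) :
    w.value S + w.value Sᶜ = w.value univ :=
  sum_add_sum_compl S _

lemma Valuation.value_mono (w : Valuation m) {S T : Finset (Fin m)} (h : S ⊆ T) :
    w.value S ≤ w.value T :=
  sum_le_sum_of_subset_of_nonneg h fun j _ _ => (w j).2.le

lemma Valuation.eq_of_subset_of_value_le (w : Valuation m) {S T : Finset (Fin m)} (h : S ⊆ T)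
    (hv : w.value T ≤ w.value S) : S = T := by
  by_contra hne
  obtain ⟨x, hxT, hxS⟩ := exists_of_ssubset (h.ssubset_of_ne hne)
  have := sum_lt_sum_of_subset (f := fun j => (w j : ℝ)) h hxT hxS (w x).2
    fun j _ _ => (w j).2.le
  exact absurd hv (not_le.2 this)

lemma Valuation.value_empty (w : Valuation m) : w.value ∅ = 0 := sum_empty

lemma Valuation.value_singleton (w : Valuation m) (x : Fin m) : w.value {x} = w x :=
  sum_singleton _ x

/-- The valuation with the given natural weights, where weight zero becomes a value so small that
all such items together are worth less than one. -/
noncomputable def Valuation.ofWeight (g : Fin m → ℕ) : Valuation m := fun j =>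
  ⟨if g j = 0 then 1 / (m + 1) else g j, by
    split_ifs with h
    · positivity
    · exact_mod_cast Nat.pos_of_ne_zero h⟩

lemma Valuation.weight_le_value_ofWeight (g : Fin m → ℕ) (S : Finset (Fin m)) :
    (weight g S : ℝ) ≤ (ofWeight g).value S := by
  rw [weight, Nat.cast_sum]
  refine sum_le_sum fun j _ => ?_
  simp only [ofWeight]
  split_ifs with h
  · rw [h, Nat.cast_zero]
    positivity
  · exact le_rfl

lemma Valuation.value_ofWeight_lt (g : Fin m → ℕ) (S : Finset (Fin m)) :
    (ofWeight g).value S < weight g S + 1 := by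
  have h1 : (ofWeight g).value S ≤ ∑ j ∈ S, ((g j : ℝ) + 1 / (m + 1)) := by
    refine sum_le_sum fun j _ => ?_
    simp only [ofWeight]
    split_ifs with h
    · rw [h, Nat.cast_zero, zero_add]
    · have : (0 : ℝ) ≤ 1 / (m + 1) := by positivity
      linarith
  rw [sum_add_distrib, sum_const, nsmul_eq_mul] at h1
  have h2 : (S.card : ℝ) ≤ m := by
    have := card_le_univ S
    rw [Fintype.card_fin] at this
    exact_mod_cast this
  have h3 : (S.card : ℝ) * (1 / (m + 1)) < 1 := by
    rw [mul_one_div, div_lt_one (by positivity)]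
    linarith
  rw [weight, Nat.cast_sum]
  linarith

/-- A value exceeds the weight by less than one, so rounding preserves weak inequalities. -/
lemma Valuation.weight_le_of_value_le {g : Fin m → ℕ} {S T : Finset (Fin m)}
    (h : (ofWeight g).value S ≤ (ofWeight g).value T) : weight g S ≤ weight g T := by
  have h1 := weight_le_value_ofWeight g S
  have h2 := value_ofWeight_lt g T
  have : (weight g S : ℝ) < weight g T + 1 := by linarith
  exact Nat.lt_succ_iff.1 (by exact_mod_cast this)

lemma Valuation.value_lt_of_weight_lt {g : Fin m → ℕ} {S T : Finset (Fin m)}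
    (h : weight g S < weight g T) : (ofWeight g).value S < (ofWeight g).value T := by
  by_contra! hc
  exact absurd (weight_le_of_value_le hc) (not_le.2 h)

lemma fin_two_eq_or (i k : Fin 2) : k = i ∨ k = i + 1 := by
  revert i k
  decide

lemma fin_two_add_one_ne (i : Fin 2) : i + 1 ≠ i := by
  revert i
  decide

/-- The profile in which player `i` has valuation `w` and the other player `w'`. -/
def profileOf (i : Fin 2) (w w' : Valuation m) : Profile m := fun k => if k = i then w else w'

lemma profileOf_self (i : Fin 2) (w w' : Valuation m) : profileOf i w w' i = w := if_pos rfl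

lemma profileOf_other (i : Fin 2) (w w' : Valuation m) : profileOf i w w' (i + 1) = w' :=
  if_neg (fin_two_add_one_ne i)

lemma update_self_eq_profileOf (v : Profile m) (i : Fin 2) (u : Valuation m) :
    Function.update v i u = profileOf i u (v (i + 1)) := by
  funext k
  rcases fin_two_eq_or i k with rfl | rfl
  · rw [profileOf_self, Function.update_self]
  · rw [profileOf_other, Function.update_of_ne (fin_two_add_one_ne i)]

lemma update_other_eq_profileOf (v : Profile m) (i : Fin 2) (u : Valuation m) :
    Function.update v (i + 1) u = profileOf i (v i) u := by
  funext k
  rcases fin_two_eq_or i k with rfl | rfl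
  · rw [profileOf_self, Function.update_of_ne (fin_two_add_one_ne k).symm]
  · rw [profileOf_other, Function.update_self]

lemma profileOf_add_one (i : Fin 2) (w w' : Valuation m) :
    profileOf (i + 1) w' w = profileOf i w w' := by
  funext k
  rcases fin_two_eq_or i k with rfl | rfl
  · rw [profileOf_self]
    exact if_neg (fin_two_add_one_ne k).symm
  · rw [profileOf_other, profileOf_self]

lemma Allocation.bundle_add_one (A : Allocation m) (i : Fin 2) :
    A.bundle (i + 1) = (A.bundle i)ᶜ := by
  have h : A.bundle 1 = (A.bundle 0)ᶜ :=
    (IsCompl.of_eq (disjoint_iff.1 A.disjoint) A.cover).compl_eq.symm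
  rcases fin_two_eq_or 0 i with rfl | rfl
  · exact h
  · change A.bundle 0 = (A.bundle 1)ᶜ
    rw [h, compl_compl]

/-- The allocation that gives `S` to player `i` and the other items to the other player. -/
def Allocation.ofBundle (i : Fin 2) (S : Finset (Fin m)) : Allocation m where
  bundle k := if k = i then S else Sᶜ
  disjoint := by
    rcases fin_two_eq_or 0 i with rfl | rfl
    · exact disjoint_compl_right
    · exact disjoint_compl_left
  cover := by
    rcases fin_two_eq_or 0 i with rfl | rfl
    · exact union_compl S
    · exact (union_comm _ _).trans (union_compl S)

lemma Allocation.ofBundle_self (i : Fin 2) (S : Finset (Fin m)) : (ofBundle i S).bundle i = S :=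
  if_pos rfl

namespace Mechanism

variable {X : Mechanism m}

lemma Truthful.profileOf_self_le (hT : X.Truthful) (i : Fin 2) (w u w' : Valuation m) :
    w.value ((X (profileOf i u w')).bundle i) ≤ w.value ((X (profileOf i w w')).bundle i) := by
  have := hT (profileOf i w w') i u
  rwa [update_self_eq_profileOf, profileOf_self, profileOf_other] at this

lemma Truthful.profileOf_other_le (hT : X.Truthful) (i : Fin 2) (w w' u : Valuation m) :
    w'.value ((X (profileOf i w u)).bundle (i + 1)) ≤
      w'.value ((X (profileOf i w w')).bundle (i + 1)) := by
  have := hT (profileOf i w w') (i + 1) u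
  rwa [update_other_eq_profileOf, profileOf_self, profileOf_other] at this

lemma profileOf_eta (v : Profile m) (i : Fin 2) : profileOf i (v i) (v (i + 1)) = v := by
  rw [← update_other_eq_profileOf, Function.update_eq_self]

/-- The bundle of the player other than `i`, as a function of natural weights. -/
noncomputable def otherBundle (X : Mechanism m) (i : Fin 2) (f g : Fin m → ℕ) : Finset (Fin m) :=
  (X (profileOf i (Valuation.ofWeight f) (Valuation.ofWeight g))).bundle (i + 1)

lemma otherBundle_add_one (X : Mechanism m) (i : Fin 2) :
    X.otherBundle (i + 1) = swapPlayers (X.otherBundle i) := by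
  funext f g
  simp only [otherBundle, swapPlayers]
  rw [profileOf_add_one, Allocation.bundle_add_one _ (i + 1)]

/-- A strict gap between weights is a strict gap between values, so an exchange that improves both
weights would contradict Pareto efficiency. -/
lemma isTruthfulEfficient_otherBundle (hP : X.ParetoEfficient) (hT : X.Truthful) (i : Fin 2) :
    IsTruthfulEfficient (X.otherBundle i) where
  first f f' g := by
    apply Valuation.weight_le_of_value_le
    have h := hT.profileOf_self_le i (.ofWeight f) (.ofWeight f') (.ofWeight g)
    have h1 := (Valuation.ofWeight f).value_add_compl
      ((X (profileOf i (.ofWeight f) (.ofWeight g))).bundle i)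
    have h2 := (Valuation.ofWeight f).value_add_compl
      ((X (profileOf i (.ofWeight f') (.ofWeight g))).bundle i)
    rw [← Allocation.bundle_add_one] at h1 h2
    simp only [otherBundle]
    linarith
  second f g g' := Valuation.weight_le_of_value_le
    (hT.profileOf_other_le i (.ofWeight f) (.ofWeight g) (.ofWeight g'))
  efficient f g A hf := by
    by_contra! hg
    have hf' := Valuation.value_lt_of_weight_lt hf
    have hg' := Valuation.value_lt_of_weight_lt hg
    have hlt : ∀ k, (profileOf i (.ofWeight f) (.ofWeight g) k).value
        ((X (profileOf i (.ofWeight f) (.ofWeight g))).bundle k) <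
        (profileOf i (.ofWeight f) (.ofWeight g) k).value
          ((Allocation.ofBundle (i + 1) A).bundle k) := by
      intro k
      rcases fin_two_eq_or i k with rfl | rfl
      · have h1 := (Valuation.ofWeight f).value_add_compl
          ((X (profileOf k (.ofWeight f) (.ofWeight g))).bundle k)
        have h2 := (Valuation.ofWeight f).value_add_compl A
        rw [← Allocation.bundle_add_one] at h1
        have h3 : (Allocation.ofBundle (k + 1) A).bundle k = Aᶜ :=
          if_neg (fin_two_add_one_ne k).symm
        rw [profileOf_self, h3]
        simp only [otherBundle] at hf'
        linarith
      · rw [profileOf_other, Allocation.ofBundle_self]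
        exact hg'
    exact hP _ ⟨Allocation.ofBundle (i + 1) A, fun k => (hlt k).le, i, hlt i⟩

/-- What player `i` can secure under natural weights, she can secure under all valuations. -/
lemma Truthful.value_le_of_secures (hT : X.Truthful) {i : Fin 2} {S : Finset (Fin m)}
    (hS : Secures (X.otherBundle i) S) (v : Profile m) :
    (v i).value S ≤ (v i).value ((X v).bundle i) := by
  -- Against the report `e` the opponent gets nothing of `S`, whatever her real valuation: otherwise
  -- an opponent of type `e` would imitate her. Player `i` can therefore report `e` to obtain `S`.
  let e : Fin m → ℕ := fun x => if x ∈ S then 1 else 0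
  have he : weight e (X.otherBundle i e e) = 0 := by
    have h1 := hS e e
    have h2 : weight e Sᶜ = 0 := sum_eq_zero fun x hx => if_neg (mem_compl.1 hx)
    omega
  have hsub : S ⊆ (X (profileOf i (.ofWeight e) (v (i + 1)))).bundle i := by
    intro x hx
    by_contra hxb
    have h1 : x ∈ (X (profileOf i (.ofWeight e) (v (i + 1)))).bundle (i + 1) := by
      rw [Allocation.bundle_add_one]
      exact mem_compl.2 hxb
    have h2 := le_weight e h1
    have h3 := Valuation.weight_le_of_value_le
      (hT.profileOf_other_le i (.ofWeight e) (.ofWeight e) (v (i + 1)))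
    have h4 : e x = 1 := if_pos hx
    simp only [otherBundle] at he
    omega
  have h := hT v i (.ofWeight e)
  rw [update_self_eq_profileOf] at h
  exact ((v i).value_mono hsub).trans h

/-- Values are strictly positive, so the bundle of everything survives replacing the two reports in
turn by uniform ones, and `secures_of_disjoint` applies there. -/
lemma Truthful.secures_univ_of_bundle_eq_univ (hT : X.Truthful)
    {i : Fin 2} (hZ : IsTruthfulEfficient (X.otherBundle i)) {v : Profile m}
    (hv : (X v).bundle i = univ) : Secures (X.otherBundle i) univ := by
  let e : Fin m → ℕ := fun _ => 1
  have h1 : (X (profileOf i (.ofWeight e) (v (i + 1)))).bundle i = univ := by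
    have := hT.profileOf_self_le i (.ofWeight e) (v i) (v (i + 1))
    rw [profileOf_eta, hv] at this
    exact Valuation.eq_of_subset_of_value_le _ (subset_univ _) this
  have h2 : X.otherBundle i e e = ∅ := by
    have := hT.profileOf_other_le i (.ofWeight e) (v (i + 1)) (.ofWeight e)
    rw [Allocation.bundle_add_one _ i, Allocation.bundle_add_one _ i, h1, compl_univ] at this
    rw [otherBundle, Allocation.bundle_add_one]
    exact (Valuation.eq_of_subset_of_value_le _ (empty_subset _) this).symm
  refine hZ.secures_of_disjoint (f := e) (g := e) (fun x _ => ?_) fun x _ => ?_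
  · rw [compl_univ, weight_empty]
    exact one_pos
  · rw [h2]
    exact notMem_empty x

end Mechanism

/-! ### The three kinds of picking-exchange mechanism -/

lemma isSetOfOffers_empty : IsSetOfOffers ({∅} : Finset (Finset (Fin m))) ∅ := Or.inl ⟨rfl, rfl⟩

lemma isValidDeals_empty (S T : Finset (Fin m)) : IsValidDeals ∅ S T :=
  ⟨fun _ h => absurd h (notMem_empty _), fun _ h => absurd h (notMem_empty _)⟩

/-- Player `i` owns all items. -/
def PickingExchange.ownership (m : ℕ) (i : Fin 2) : PickingExchange m where
  N _ := ∅
  E k := if k = i then univ else ∅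
  O _ := {∅}
  D := ∅
  disjoint_N := disjoint_empty_left _
  disjoint_E := by
    rcases fin_two_eq_or 0 i with rfl | rfl <;> simp
  disjoint_N_E _ _ := disjoint_empty_left _
  cover := by
    rcases fin_two_eq_or 0 i with rfl | rfl <;> simp
  offers _ := isSetOfOffers_empty
  valid := isValidDeals_empty _ _

lemma PickingExchange.ownership_implements {X : Mechanism m} {i : Fin 2}
    (h : ∀ v, (X v).bundle i = univ) : (ownership m i).Implements X := by
  intro v
  have h' := (X v).bundle_add_one i
  rw [h v, compl_univ] at h'
  refine ⟨fun k => by simp [ownership], ∅, empty_subset _, ?_, ?_, ?_⟩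
  · exact fun d hd => absurd hd (notMem_empty d)
  · exact fun d hd => absurd hd (notMem_empty d)
  · have h0 := h v
    rcases fin_two_eq_or 0 i with rfl | rfl
    · simp [ownership, h0]
    · have h1 : (X v).bundle 0 = ∅ := h'
      simp [ownership, h1]

/-- Player `i` picks all items but one. -/
def PickingExchange.leaveOne (hm : 2 ≤ m) (i : Fin 2) : PickingExchange m where
  N k := if k = i then univ else ∅
  E _ := ∅
  O k := if k = i then univ.filter fun S => S.card + 1 = m else {∅}
  D := ∅
  disjoint_N := by
    rcases fin_two_eq_or 0 i with rfl | rfl <;> simp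
  disjoint_E := disjoint_empty_left _
  disjoint_N_E _ _ := disjoint_empty_right _
  cover := by
    rcases fin_two_eq_or 0 i with rfl | rfl <;> simp
  offers k := by
    by_cases hk : k = i
    · have herase : ∀ x : Fin m, (univ.erase x).card + 1 = m := by
        intro x
        rw [card_erase_add_one (mem_univ x), card_univ, Fintype.card_fin]
      simp only [if_pos hk]
      right
      refine ⟨⟨univ.erase ⟨0, by omega⟩, mem_filter.2 ⟨mem_univ _, herase _⟩⟩, ?_, ?_, fun x => ?_⟩
      · intro T hT
        rw [mem_filter] at hT
        refine ssubset_univ_iff.2 fun h => ?_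
        have := hT.2
        rw [h, card_univ, Fintype.card_fin] at this
        omega
      · refine eq_univ_iff_forall.2 fun x => ?_
        have : Nontrivial (Fin m) := Fin.nontrivial_iff_two_le.2 hm
        obtain ⟨y, hy⟩ := exists_ne x
        exact mem_biUnion.2 ⟨univ.erase y, mem_filter.2 ⟨mem_univ _, herase y⟩, by simp [hy.symm]⟩
      · exact ⟨univ.erase x, mem_filter.2 ⟨mem_univ _, herase x⟩, notMem_erase x _⟩
    · simp only [if_neg hk]
      exact isSetOfOffers_empty
  valid := isValidDeals_empty _ _

lemma PickingExchange.leaveOne_implements {X : Mechanism m} (hm : 2 ≤ m) {i : Fin 2}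
    (hne : ∀ v, (X v).bundle i ≠ univ)
    (h : ∀ v : Profile m, ∀ S, S ≠ univ → (v i).value S ≤ (v i).value ((X v).bundle i)) :
    (leaveOne hm i).Implements X := by
  intro v
  refine ⟨fun k => ?_, ∅, empty_subset _, ?_, ?_, ?_⟩
  · by_cases hk : k = i
    · subst hk
      simp only [leaveOne, if_true, inter_univ, mem_filter, mem_univ, true_and]
      constructor
      · obtain ⟨x, hx⟩ : ∃ x, x ∉ (X v).bundle k := by
          by_contra! hall
          exact hne v (eq_univ_iff_forall.2 hall)
        -- The bundle lies in `univ.erase x` and is worth at least as much, so strict positivity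
        -- makes them equal.
        have hsub : (X v).bundle k ⊆ univ.erase x := fun y hy =>
          mem_erase.2 ⟨fun hyx => hx (hyx ▸ hy), mem_univ y⟩
        have he : univ.erase x ≠ univ := fun he => notMem_erase x univ (by rw [he]; exact mem_univ x)
        rw [(v k).eq_of_subset_of_value_le hsub (h v _ he), card_erase_add_one (mem_univ x),
          card_univ, Fintype.card_fin]
      · intro S hS
        refine h v S fun he => ?_
        rw [he, card_univ, Fintype.card_fin] at hS
        omega
    · simp [leaveOne, hk]
  · exact fun d hd => absurd hd (notMem_empty d)
  · exact fun d hd => absurd hd (notMem_empty d)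
  · simp [leaveOne]

/-- Two items, one for each player, that are exchanged if both players want to. -/
def PickingExchange.swapTwo {a b : Fin m} (hab : a ≠ b) (hall : ∀ x, x = a ∨ x = b) :
    PickingExchange m where
  N _ := ∅
  E k := if k = 0 then {a} else {b}
  O _ := {∅}
  D := {({a}, {b})}
  disjoint_N := disjoint_empty_left _
  disjoint_E := by simpa using hab
  disjoint_N_E _ _ := disjoint_empty_left _
  cover := eq_univ_iff_forall.2 fun x => by
    simpa [or_comm] using hall x
  offers _ := isSetOfOffers_empty
  valid := by
    refine ⟨fun d hd => ?_, fun d hd e he hne => ?_⟩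
    · rw [mem_singleton.1 hd]
      simp
    · exact absurd ((mem_singleton.1 hd).trans (mem_singleton.1 he).symm) hne

/-- The guarantees give each player one item and rule out an unfavorable exchange; efficiency
enforces a favorable one. -/
lemma PickingExchange.swapTwo_implements {X : Mechanism m} (hP : X.ParetoEfficient)
    {a b : Fin m} (hab : a ≠ b) (hall : ∀ x, x = a ∨ x = b)
    (ha : ∀ v : Profile m, (v 0).value {a} ≤ (v 0).value ((X v).bundle 0))
    (hb : ∀ v : Profile m, (v 1).value {b} ≤ (v 1).value ((X v).bundle 1)) :
    (swapTwo hab hall).Implements X := by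
  intro v
  refine ⟨fun k => by simp [swapTwo], ?_⟩
  have hcompl : (X v).bundle 1 = ((X v).bundle 0)ᶜ := (X v).bundle_add_one 0
  have hac : ({a} : Finset (Fin m))ᶜ = {b} := by
    ext x
    rcases hall x with rfl | rfl
    · simp [hab]
    · simp [hab.symm]
  have hbc : ({b} : Finset (Fin m))ᶜ = {a} := by rw [← hac, compl_compl]
  have hE : (swapTwo hab hall).E 0 ∪ (swapTwo hab hall).E 1 = univ :=
    eq_univ_iff_forall.2 fun x => by simpa [swapTwo, or_comm] using hall x
  have hcases : (X v).bundle 0 = {a} ∨ (X v).bundle 0 = {b} := by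
    by_cases h1 : a ∈ (X v).bundle 0
    · left
      have h2 : b ∉ (X v).bundle 0 := by
        intro h2
        have h3 : (X v).bundle 1 = ∅ := by
          rw [hcompl, compl_eq_empty_iff]
          exact eq_univ_iff_forall.2 fun x => by rcases hall x with rfl | rfl <;> assumption
        have := hb v
        rw [h3, Valuation.value_empty, Valuation.value_singleton] at this
        exact absurd this (not_le.2 (v 1 b).2)
      ext x
      rcases hall x with rfl | rfl
      · simp [h1]
      · simp [h2, hab.symm]
    · right
      have h2 : b ∈ (X v).bundle 0 := by
        by_contra h2
        have h3 : (X v).bundle 0 = ∅ := eq_empty_iff_forall_notMem.2 fun x => by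
          rcases hall x with rfl | rfl <;> assumption
        have := ha v
        rw [h3, Valuation.value_empty, Valuation.value_singleton] at this
        exact absurd this (not_le.2 (v 0 a).2)
      ext x
      rcases hall x with rfl | rfl
      · simp [h1, hab]
      · simp [h2]
  rw [hE, inter_univ]
  rcases hcases with h0 | h0
  · have h1 : (X v).bundle 1 = {b} := by rw [hcompl, h0, hac]
    refine ⟨∅, empty_subset _, fun d hd hfav => ?_, fun d hd => absurd hd (notMem_empty d), ?_⟩
    · exfalso
      rw [mem_singleton.1 hd] at hfav
      have hA1 : (Allocation.ofBundle 0 {b} : Allocation m).bundle 1 = {a} := hbc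
      have hlt : ∀ k, (v k).value ((X v).bundle k) <
          (v k).value ((Allocation.ofBundle 0 {b}).bundle k) := by
        intro k
        rcases fin_two_eq_or 0 k with rfl | rfl
        · rw [h0, Allocation.ofBundle_self]
          exact hfav.1
        · change (v 1).value ((X v).bundle 1) <
            (v 1).value ((Allocation.ofBundle 0 {b}).bundle 1)
          rw [h1, hA1]
          exact hfav.2
      exact hP v ⟨_, fun k => (hlt k).le, 0, hlt 0⟩
    · simp [h0, swapTwo]
  · have h1 : (X v).bundle 1 = {a} := by rw [hcompl, h0, hbc]
    refine ⟨_, subset_rfl, fun d hd _ => hd, fun d hd hunf => ?_, ?_⟩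
    · rw [mem_singleton.1 hd] at hunf
      have k1 := ha v
      have k2 := hb v
      rw [h0] at k1
      rw [h1] at k2
      exact hunf.elim (not_lt.2 k1) (not_lt.2 k2)
    · simp [h0, swapTwo]

lemma Mechanism.exists_of_secures_singletons {X : Mechanism m} (hP : X.ParetoEfficient)
    (hT : X.Truthful) {i : Fin 2} (hs : ∀ x, Secures (X.otherBundle i) {x}) :
    ∃ P : PickingExchange m, P.Implements X ∧
      (P.E i = univ ∨ P.N i = univ ∧ ∀ S, S ∈ P.O i ↔ S ⊆ P.N i ∧ S.card + 1 = m) := by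
  have hZ := isTruthfulEfficient_otherBundle hP hT i
  by_cases hu : Secures (X.otherBundle i) univ
  · refine ⟨.ownership m i, PickingExchange.ownership_implements fun v => ?_, Or.inl (if_pos rfl)⟩
    exact (v i).eq_of_subset_of_value_le (subset_univ _) (hT.value_le_of_secures hu v)
  · have hm : 2 ≤ m := by
      by_contra! hm
      -- With at most one item the whole set is empty or a singleton, hence secured.
      interval_cases m
      · exact hu ((univ_eq_empty (α := Fin 0)).symm ▸ secures_empty)
      · exact hu ((univ_unique (α := Fin 1)) ▸ hs _)
    refine ⟨.leaveOne hm i, PickingExchange.leaveOne_implements hm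
      (fun v hv => hu (hT.secures_univ_of_bundle_eq_univ hZ hv)) (fun v S hS =>
        hT.value_le_of_secures (hZ.secures_of_ne_univ hs _ S rfl hS) v),
      Or.inr ⟨if_pos rfl, fun S => ?_⟩⟩
    simp [PickingExchange.leaveOne]

end TwoPlayer

open TwoPlayer in
theorem mainTheorem11 (m : ℕ) (X : TwoPlayer.Mechanism m)
    (hP : X.ParetoEfficient) (hT : X.Truthful) :
    ∃ P : TwoPlayer.PickingExchange m, P.Implements X ∧
      ((∃ i : Fin 2, P.E i = Finset.univ) ∨
       (∃ (j : Fin m) (i₁ i₂ : Fin 2), i₁ ≠ i₂ ∧ P.E i₁ = {j} ∧ P.E i₂ = Finset.univ \ {j} ∧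
          P.D = {(P.E 0, P.E 1)}) ∨
       (∃ i : Fin 2, P.N i = Finset.univ ∧
          ∀ S : Finset (Fin m), S ∈ P.O i ↔ S ⊆ P.N i ∧ S.card + 1 = m)) := by
  by_cases h : ∃ i, ∀ x, Secures (X.otherBundle i) {x}
  · obtain ⟨i, hi⟩ := h
    obtain ⟨P, hPX, hE | hN⟩ := Mechanism.exists_of_secures_singletons hP hT hi
    · exact ⟨P, hPX, Or.inl ⟨i, hE⟩⟩
    · exact ⟨P, hPX, Or.inr (Or.inr ⟨i, hN⟩)⟩
  · push Not at h
    have hZ := fun i => Mechanism.isTruthfulEfficient_otherBundle hP hT i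
    have hor : ∀ i x, Secures (X.otherBundle i) {x} ∨ Secures (X.otherBundle (i + 1)) {x} := by
      intro i x
      rw [Mechanism.otherBundle_add_one]
      exact (hZ i).secures_or_swapPlayers x
    obtain ⟨b, hb⟩ := h 0
    obtain ⟨a, ha⟩ := h 1
    have hb1 : Secures (X.otherBundle 1) {b} := (hor 0 b).resolve_left hb
    have ha0 : Secures (X.otherBundle 0) {a} := (hor 1 a).resolve_left ha
    have hab : a ≠ b := fun h => hb (h ▸ ha0)
    have hall : ∀ x, x = a ∨ x = b := by
      intro x
      by_contra! hx
      have e0 : X.otherBundle 1 = swapPlayers (X.otherBundle 0) := X.otherBundle_add_one 0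
      have e1 : X.otherBundle 0 = swapPlayers (X.otherBundle 1) := X.otherBundle_add_one 1
      -- Whoever secures `x` holds two singletons against the other player's one.
      rcases hor 0 x with h0 | h1
      · exact (hZ 0).three_items hx.1.symm hab hx.2 ha0 h0 (e0 ▸ hb1)
      · exact (hZ 1).three_items hx.2.symm hab.symm hx.1 hb1 h1 (e1 ▸ ha0)
    refine ⟨.swapTwo hab hall, PickingExchange.swapTwo_implements hP hab hall
      (hT.value_le_of_secures ha0) (hT.value_le_of_secures hb1), Or.inr (Or.inl
        ⟨a, 0, 1, by decide, rfl, ?_, rfl⟩)⟩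
    ext x
    rcases hall x with rfl | rfl
    · simp [PickingExchange.swapTwo, hab]
    · simp [PickingExchange.swapTwo, hab.symm]
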